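/- Let $\Lambda$ be an arbitrary set (finite or infinite, countable or uncountable), let $\mathbb{F}^+_\Lambda$ be the free semigroup with unit $e$ (the empty word) generated by $\{z_\alpha\}_{\alpha\in\Lambda}$, and let $\mathcal{H}_\Lambda=\ell^2(\mathbb{F}^+_\Lambda)$ be the complex Hilbert space of square summable functions on $\mathbb{F}^+_\Lambda$, with orthonormal basis $\{\xi_w\}$ of indicator functions of single words $w\in\mathbb{F}^+_\Lambda$. For $\alpha\in\Lambda$ let $L_\alpha$ be the isometry of $\mathcal{H}_\Lambda$ with $L_\alpha\xi_w=\xi_{z_\alpha w}$ for all $w$, and for a word $u=z_{\alpha_1}\cdots z_{\alpha_n}$ let $L_u=L_{\alpha_1}\cdots L_{\alpha_n}$ (so $L_e=I$). For $\varphi,\psi\in\mathcal{H}_\Lambda$ define the convolution by the finite sums $$(\varphi*\psi)(w)=\sum_{uv=w}\varphi(u)\psi(v),\qquad w\in\mathbb{F}^+_\Lambda .$$ Let $\mathscr{L}_\Lambda\subseteq B(\mathcal{H}_\Lambda)$ be the set of all bounded left convolution operators, that is, of all $T\in B(\mathcal{H}_\Lambda)$ for which there is $\varphi\in\mathcal{H}_\Lambda$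 with $T\psi=\varphi*\psi$ for every $\psi\in\mathcal{H}_\Lambda$. Let $\mathfrak{L}_\Lambda$ be the left regular free semigroup algebra, that is, the (unital) weak-operator closed subalgebra of $B(\mathcal{H}_\Lambda)$ generated by $\{L_\alpha\}_{\alpha\in\Lambda}$. Then $\mathscr{L}_\Lambda$ is the weak-operator closure of $\operatorname{span}\{L_w : w\in\mathbb{F}^+_\Lambda\}$. That is, $\mathscr{L}_\Lambda=\mathfrak{L}_\Lambda$. -/

import Mathlib

open scoped ENNReal

namespace FreeSemigroupAlgebra

/-- The Hilbert space `ℓ²(𝔽⁺_Λ)`. The free semigroup with unit `𝔽⁺_Λ` generated by `Λ` is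
`FreeMonoid Λ`; the unit `e` is the empty word. -/
abbrev H (Λ : Type*) : Type _ := lp (fun _ : FreeMonoid Λ => ℂ) 2

/-- The function `w ↦ ψ (z_α⁻¹ w)` if `z_α` divides `w` on the left, and `w ↦ 0` otherwise. -/
noncomputable def shiftFun {Λ : Type*} (α : Λ) (ψ : FreeMonoid Λ → ℂ) : FreeMonoid Λ → ℂ :=
  Function.extend (fun v => FreeMonoid.of α * v) ψ 0

theorem of_mul_injective {Λ : Type*} (α : Λ) :
    Function.Injective (fun v : FreeMonoid Λ => FreeMonoid.of α * v) :=
  mul_right_injective _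

theorem norm_shiftFun_rpow {Λ : Type*} (α : Λ) (ψ : FreeMonoid Λ → ℂ) :
    (fun w => ‖shiftFun α ψ w‖ ^ (2 : ℝ≥0∞).toReal) =
      Function.extend (fun v => FreeMonoid.of α * v) (fun v => ‖ψ v‖ ^ (2 : ℝ≥0∞).toReal) 0 := by
  funext w
  by_cases hw : ∃ v, FreeMonoid.of α * v = w
  · obtain ⟨v, rfl⟩ := hw
    simp only [shiftFun]
    rw [(of_mul_injective α).extend_apply, (of_mul_injective α).extend_apply]
  · simp only [shiftFun]
    rw [Function.extend_apply' _ _ _ hw, Function.extend_apply' _ _ _ hw]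
    simp

theorem memℓp_shiftFun {Λ : Type*} (α : Λ) (ψ : H Λ) : Memℓp (shiftFun α ψ) 2 := by
  refine memℓp_gen ?_
  rw [norm_shiftFun_rpow]
  exact (summable_extend_zero (of_mul_injective α)).2 (ψ.2.summable (by simp))

/-- The generator `L_α` of the left regular representation, `L_α ξ_w = ξ_{z_α w}`, as a linear
isometry of `ℓ²(𝔽⁺_Λ)`. -/
noncomputable def generatorIsometry {Λ : Type*} (α : Λ) : H Λ →ₗᵢ[ℂ] H Λ where
  toFun ψ := ⟨shiftFun α ψ, memℓp_shiftFun α ψ⟩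
  map_add' ψ χ := by
    ext w
    change shiftFun α (⇑ψ + ⇑χ) w = shiftFun α ψ w + shiftFun α χ w
    by_cases hw : ∃ v, FreeMonoid.of α * v = w
    · obtain ⟨v, rfl⟩ := hw
      simp only [shiftFun]
      simp_rw [(of_mul_injective α).extend_apply]
      rfl
    · simp [shiftFun, Function.extend_apply' _ _ _ hw]
  map_smul' c ψ := by
    ext w
    by_cases hw : ∃ v, FreeMonoid.of α * v = w
    · obtain ⟨v, rfl⟩ := hw
      simp [shiftFun, (of_mul_injective α).extend_apply]
    · simp [shiftFun, Function.extend_apply' _ _ _ hw]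
  norm_map' ψ := by
    have h2 : 0 < (2 : ℝ≥0∞).toReal := by simp
    refine (Real.rpow_left_inj (norm_nonneg _) (norm_nonneg _) h2.ne').1 ?_
    rw [lp.norm_rpow_eq_tsum h2, lp.norm_rpow_eq_tsum h2]
    change ∑' w, ‖shiftFun α ψ w‖ ^ (2 : ℝ≥0∞).toReal = _
    rw [norm_shiftFun_rpow, tsum_extend_zero (of_mul_injective α)]

/-- The bounded operator `L_w` of a word `w = z_{α₁} ⋯ z_{αₙ}`, namely `L_{α₁} ⋯ L_{αₙ}`
(the identity for the empty word). -/
noncomputable def wordOp {Λ : Type*} : FreeMonoid Λ →* (H Λ →L[ℂ] H Λ) :=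
  FreeMonoid.lift fun α => (generatorIsometry α).toContinuousLinearMap

/-- `L_α ξ_w = ξ_{z_α w}`. -/
theorem generatorIsometry_single {Λ : Type*} [DecidableEq (FreeMonoid Λ)] (α : Λ)
    (w : FreeMonoid Λ) :
    generatorIsometry α (lp.single 2 w (1 : ℂ) : H Λ) =
      lp.single 2 (FreeMonoid.of α * w) (1 : ℂ) := by
  ext u
  change shiftFun α _ u = _
  by_cases hu : ∃ v, FreeMonoid.of α * v = u
  · obtain ⟨v, rfl⟩ := hu
    simp [shiftFun, (of_mul_injective α).extend_apply, lp.single_apply, Pi.single_apply]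
  · have h : u ≠ FreeMonoid.of α * w := fun h => hu ⟨w, h.symm⟩
    simp [shiftFun, Function.extend_apply' _ _ _ hu, lp.single_apply, h]

/-- `L_u ξ_w = ξ_{u w}`. -/
theorem wordOp_single {Λ : Type*} [DecidableEq (FreeMonoid Λ)] (u w : FreeMonoid Λ) :
    wordOp u (lp.single 2 w (1 : ℂ) : H Λ) = lp.single 2 (u * w) (1 : ℂ) := by
  induction u using FreeMonoid.inductionOn' with
  | one => simp
  | of_mul α u ih =>
    rw [map_mul, mul_apply_eq_comp, ih, mul_assoc, ← generatorIsometry_single]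
    simp [wordOp]

/-- A word has only finitely many factorizations `w = u v`. -/
theorem finite_factorizations {Λ : Type*} (w : FreeMonoid Λ) :
    {p : FreeMonoid Λ × FreeMonoid Λ | p.1 * p.2 = w}.Finite := by
  refine ((Set.finite_Iic w.length).image fun k =>
    (FreeMonoid.ofList (w.toList.take k), FreeMonoid.ofList (w.toList.drop k))).subset ?_
  rintro ⟨u, v⟩ rfl
  refine ⟨u.length, by simp, ?_⟩
  simp [FreeMonoid.length]

/-- The factorizations `w = u v` of a word. By cancellation, they correspond to the left divisors
`u` of `w`, with `v = u⁻¹ w`. -/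
noncomputable def factorizations {Λ : Type*} (w : FreeMonoid Λ) :
    Finset (FreeMonoid Λ × FreeMonoid Λ) :=
  (finite_factorizations w).toFinset

/-- The convolution `(φ * ψ)(w) = ∑_{u ∣ w} φ(u) ψ(u⁻¹ w)`, a finite sum. -/
noncomputable def convolution {Λ : Type*} (φ ψ : FreeMonoid Λ → ℂ) : FreeMonoid Λ → ℂ :=
  fun w => ∑ p ∈ factorizations w, φ p.1 * ψ p.2

/-- `T` is the left convolution operator `L_φ : ψ ↦ φ * ψ`. Such a bounded operator `T` exists
only if `φ * ψ` is square summable for every square summable `ψ`. -/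
def IsLeftConvolution {Λ : Type*} (φ : H Λ) (T : H Λ →L[ℂ] H Λ) : Prop :=
  ∀ ψ : H Λ, ⇑(T ψ) = convolution φ ψ

/-- The set `ℒ_Λ` of all bounded left convolution operators `L_φ`, `φ ∈ ℓ²(𝔽⁺_Λ)`, inside the
bounded operators on `ℓ²(𝔽⁺_Λ)` equipped with the weak operator topology. -/
def boundedLeftConvolutions (Λ : Type*) : Set (H Λ →WOT[ℂ] H Λ) :=
  {T | ∃ φ : H Λ, IsLeftConvolution φ T.toCLM}

/-- The linear span of the operators `L_w`, for all words `w`. -/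
noncomputable def wordSpan (Λ : Type*) : Submodule ℂ (H Λ →WOT[ℂ] H Λ) :=
  Submodule.span ℂ (Set.range fun w : FreeMonoid Λ => ContinuousLinearMapWOT.ofCLM (wordOp w))

/-- The left regular free semigroup algebra `𝔏_Λ`: the (unital) weak-operator closed algebra
generated by the operators `L_α`, `α ∈ Λ`. -/
noncomputable def leftRegularAlgebra (Λ : Type*) : Subalgebra ℂ (H Λ →WOT[ℂ] H Λ) :=
  (Algebra.adjoin ℂ (Set.range fun α : Λ =>
    ContinuousLinearMapWOT.ofCLM (generatorIsometry α).toContinuousLinearMap)).topologicalClosure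

end FreeSemigroupAlgebra

/-! A bounded left convolution operator `T` has symbol `T ξ_e`, so being one is a family of
equations between matrix coefficients. These are weak-operator closed conditions that every `L_w`
satisfies, which gives one inclusion. Conversely, given `L_φ`, group words by length. The `L_u` with
`|u| = n` have orthogonal ranges, so `∑_{|u| = n} φ(u) L_u` converges in norm, even for infinite
`Λ`. The Cesàro means of these components multiply the matrix coefficients of `L_φ` by Fejér weights
in the length difference, so their norms are at most `‖L_φ‖` (`norm_le_of_fejer_coeff`). Bounded
with converging coefficients, they tend to `L_φ` weakly (`tendsto_wot_of_tendsto_coeff`). -/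

open Filter Topology

namespace FreeSemigroupAlgebra

/-! ### Weak operator limits and Fejér multipliers on `ℓ²`. -/

section l2

variable {ι : Type*} [DecidableEq ι]

theorem single_eq_smul (i : ι) (a : ℂ) :
    (lp.single 2 i a : lp (fun _ : ι => ℂ) 2) = a • lp.single 2 i (1 : ℂ) := by
  rw [← lp.single_smul, smul_eq_mul, mul_one]

/-- Two continuous linear maps on `ℓ²` agree if they agree on the canonical basis. -/
theorem clm_ext_single {F : Type*} [AddCommMonoid F] [Module ℂ F] [TopologicalSpace F] [T2Space F]
    {f g : lp (fun _ : ι => ℂ) 2 →L[ℂ] F}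
    (h : ∀ i, f (lp.single 2 i (1 : ℂ)) = g (lp.single 2 i (1 : ℂ))) : f = g := by
  refine lp.ext_continuousLinearMap (by simp) fun i => ?_
  ext
  exact h i

/-- A bounded sequence of continuous linear maps on `ℓ²` that converges on the canonical basis
converges pointwise. -/
theorem tendsto_of_tendsto_single {F : Type*} [NormedAddCommGroup F] [NormedSpace ℂ F]
    {f : ℕ → lp (fun _ : ι => ℂ) 2 →L[ℂ] F} {g : lp (fun _ : ι => ℂ) 2 →L[ℂ] F} {C : ℝ}
    (hC : ∀ k, ‖f k‖ ≤ C)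
    (h : ∀ i, Tendsto (fun k => f k (lp.single 2 i (1 : ℂ))) atTop
      (𝓝 (g (lp.single 2 i (1 : ℂ)))))
    (x : lp (fun _ : ι => ℂ) 2) : Tendsto (fun k => f k x) atTop (𝓝 (g x)) := by
  have hC0 : 0 ≤ C := (norm_nonneg _).trans (hC 0)
  have hequi : Equicontinuous fun k => ⇑(f k) :=
    (LipschitzWith.uniformEquicontinuous _ C.toNNReal fun k =>
      (f k).lipschitz.weaken (by
        rw [← NNReal.coe_le_coe, coe_nnnorm, Real.coe_toNNReal _ hC0]
        exact hC k)).equicontinuous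
  -- By equicontinuity the convergence set is closed, so it suffices that it contains the finitely
  -- supported vectors.
  have hclosed := hequi.isClosed_setOfPred_tendsto (l := atTop) g.continuous
  refine hclosed.mem_of_tendsto (lp.hasSum_single (by simp) x) (Eventually.of_forall fun s => ?_)
  simp only [Set.mem_ofPred_eq, map_sum]
  refine tendsto_finsetSum _ fun i _ => ?_
  rw [single_eq_smul]
  simpa only [map_smul] using (h i).const_smul (x i)

/-- A bounded sequence of operators on `ℓ²` whose matrix coefficients converge, converges in the
weak operator topology. -/
theorem tendsto_wot_of_tendsto_coeff
    {A : ℕ → lp (fun _ : ι => ℂ) 2 →L[ℂ] lp (fun _ : ι => ℂ) 2}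
    {T : lp (fun _ : ι => ℂ) 2 →L[ℂ] lp (fun _ : ι => ℂ) 2} {C : ℝ} (hC : ∀ k, ‖A k‖ ≤ C)
    (h : ∀ i j, Tendsto (fun k => A k (lp.single 2 j (1 : ℂ)) i) atTop
      (𝓝 (T (lp.single 2 j (1 : ℂ)) i))) :
    Tendsto (fun k => ContinuousLinearMapWOT.ofCLM (A k)) atTop
      (𝓝 (ContinuousLinearMapWOT.ofCLM T)) := by
  have hC0 : 0 ≤ C := (norm_nonneg _).trans (hC 0)
  rw [ContinuousLinearMapWOT.tendsto_iff_forall_inner_apply_tendsto]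
  intro y x
  have hcoord : ∀ i, Tendsto (fun k => A k y i) atTop (𝓝 (T y i)) := by
    intro i
    refine tendsto_of_tendsto_single
      (f := fun k => (lp.evalCLM ℂ (fun _ : ι => ℂ) 2 i).comp (A k))
      (g := (lp.evalCLM ℂ (fun _ : ι => ℂ) 2 i).comp T)
      (C := ‖lp.evalCLM ℂ (fun _ : ι => ℂ) 2 i‖ * C) (fun k => ?_) (fun j => h i j) y
    exact (ContinuousLinearMap.opNorm_comp_le _ _).trans (by gcongr; exact hC k)
  have hconj : Tendsto (fun k => inner ℂ (A k y) x) atTop (𝓝 (inner ℂ (T y) x)) := by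
    refine tendsto_of_tendsto_single
      (f := fun k => innerSL ℂ (A k y)) (g := innerSL ℂ (T y))
      (C := C * ‖y‖) (fun k => ?_) (fun i => ?_) x
    · rw [innerSL_apply_norm]
      exact (A k).le_of_opNorm_le (hC k) y
    · simp only [innerSL_apply_apply, lp.inner_single_right]
      simpa [Function.comp_def] using (Complex.continuous_conj.tendsto _).comp (hcoord i)
  simpa [Function.comp_def] using (Complex.continuous_conj.tendsto _).comp hconj

/-- The restriction of `x` to a finite set of indices. -/
noncomputable def restrict (x : lp (fun _ : ι => ℂ) 2) (s : Finset ι) : lp (fun _ : ι => ℂ) 2 :=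
  ∑ i ∈ s, lp.single 2 i (x i)

theorem norm_restrict_sq (x : lp (fun _ : ι => ℂ) 2) (s : Finset ι) :
    ‖restrict x s‖ ^ 2 = ∑ i ∈ s, ‖x i‖ ^ 2 := by
  simpa [restrict] using lp.norm_sum_single (E := fun _ : ι => ℂ) (p := 2) (by simp) x s

theorem norm_restrict_le (x : lp (fun _ : ι => ℂ) 2) (s : Finset ι) : ‖restrict x s‖ ≤ ‖x‖ := by
  have h := lp.sum_rpow_le_norm_rpow (E := fun _ : ι => ℂ) (p := 2) (by simp) x s
  refine le_of_sq_le_sq ?_ (norm_nonneg _)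
  rw [norm_restrict_sq]
  simpa using h

theorem inner_restrict (A : lp (fun _ : ι => ℂ) 2 →L[ℂ] lp (fun _ : ι => ℂ) 2)
    (x y : lp (fun _ : ι => ℂ) 2) (s : Finset ι) :
    inner ℂ (restrict x s) (A (restrict y s)) =
      ∑ i ∈ s, ∑ j ∈ s, A (lp.single 2 j (1 : ℂ)) i * (y j * starRingEnd ℂ (x i)) := by
  simp only [restrict, map_sum, inner_sum, sum_inner, lp.inner_single_left]
  rw [Finset.sum_comm]
  refine Finset.sum_congr rfl fun i _ => Finset.sum_congr rfl fun j _ => ?_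
  rw [single_eq_smul, map_smul, lp.coeFn_smul, Pi.smul_apply, RCLike.inner_apply, smul_eq_mul]
  ring

/-- Realises `k` times the Fejér weight as the number of common points of two windows of length `k`.
Truncated subtraction gives 0 when the windows are disjoint. -/
theorem card_window (a b k N : ℕ) (hN : a + k ≤ N) :
    ((Finset.range N).filter fun s => (a ≤ s ∧ s < a + k) ∧ (b ≤ s ∧ s < b + k)).card =
      min a b + k - max a b := by
  rw [← Nat.card_Ico]
  congr 1
  ext s
  simp only [Finset.mem_filter, Finset.mem_range, Finset.mem_Ico]
  omega

/-- Multiplying the matrix coefficients of an operator by the Fejér kernel in the differences of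
the degrees does not increase the norm. -/
theorem norm_le_of_fejer_coeff (deg : ι → ℕ) {k : ℕ} (hk : 0 < k)
    {A T : lp (fun _ : ι => ℂ) 2 →L[ℂ] lp (fun _ : ι => ℂ) 2}
    (h : ∀ i j, (k : ℂ) * A (lp.single 2 j (1 : ℂ)) i =
      (min (deg i) (deg j) + k - max (deg i) (deg j) : ℕ) * T (lp.single 2 j (1 : ℂ)) i) :
    ‖A‖ ≤ ‖T‖ := by
  have hk' : (0 : ℝ) < k := by exact_mod_cast hk
  have key : ∀ (x y : lp (fun _ : ι => ℂ) 2) (F : Finset ι),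
      ‖inner ℂ (restrict x F) (A (restrict y F))‖ ≤ ‖T‖ * (‖x‖ * ‖y‖) := by
    intro x y F
    set N := F.sup deg + k with hN
    have hdeg : ∀ i ∈ F, deg i + k ≤ N := fun i hi => by
      have := Finset.le_sup (f := deg) hi
      omega
    -- With `P_s` the projection onto `W s`, this sets up `k A = ∑ P_s T P_s` on vectors supported
    -- in `F`. Each index of `F` lies in exactly `k` of the sets `W s`, hence `∑ ‖P_s z‖² ≤ k ‖z‖²`,
    -- and Cauchy–Schwarz cancels the factor `k`.
    let W : ℕ → Finset ι := fun s => F.filter fun i => deg i ≤ s ∧ s < deg i + k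
    have hsum : (k : ℂ) * inner ℂ (restrict x F) (A (restrict y F)) =
        ∑ s ∈ Finset.range N, inner ℂ (restrict x (W s)) (T (restrict y (W s))) := by
      simp only [inner_restrict, W, Finset.sum_filter]
      rw [Finset.mul_sum, Finset.sum_comm]
      refine Finset.sum_congr rfl fun i hi => ?_
      simp only [Finset.mul_sum]
      have : ∀ s ∈ Finset.range N, (if deg i ≤ s ∧ s < deg i + k then
          ∑ j ∈ F, (if deg j ≤ s ∧ s < deg j + k then
            T (lp.single 2 j (1 : ℂ)) i * (y j * starRingEnd ℂ (x i)) else 0) else 0) =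
          ∑ j ∈ F, if (deg i ≤ s ∧ s < deg i + k) ∧ (deg j ≤ s ∧ s < deg j + k) then
            T (lp.single 2 j (1 : ℂ)) i * (y j * starRingEnd ℂ (x i)) else 0 := by
        intro s _
        split_ifs with hs
        · simp [hs]
        · simp [hs]
      rw [Finset.sum_congr rfl this, Finset.sum_comm]
      refine Finset.sum_congr rfl fun j _ => ?_
      rw [← Finset.sum_filter, Finset.sum_const, card_window _ _ _ _ (hdeg i hi), nsmul_eq_mul,
        ← mul_assoc, h, mul_assoc]
    have hnorm : ∀ z : lp (fun _ : ι => ℂ) 2,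
        ∑ s ∈ Finset.range N, ‖restrict z (W s)‖ ^ 2 ≤ k * ‖z‖ ^ 2 := by
      intro z
      have h1 : ∑ s ∈ Finset.range N, ‖restrict z (W s)‖ ^ 2 = k * ∑ i ∈ F, ‖z i‖ ^ 2 := by
        simp only [norm_restrict_sq, W, Finset.sum_filter]
        rw [Finset.sum_comm, Finset.mul_sum]
        refine Finset.sum_congr rfl fun i hi => ?_
        have hc := card_window (deg i) (deg i) k N (hdeg i hi)
        simp only [and_self, min_self, max_self, Nat.add_sub_cancel_left] at hc
        rw [← Finset.sum_filter, Finset.sum_const, hc, nsmul_eq_mul]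
      rw [h1, ← norm_restrict_sq]
      gcongr
      exact norm_restrict_le z F
    have hcs : ∑ s ∈ Finset.range N, ‖restrict x (W s)‖ * ‖restrict y (W s)‖ ≤
        k * (‖x‖ * ‖y‖) := by
      refine (Real.sum_mul_le_sqrt_mul_sqrt _ _ _).trans ?_
      calc _ ≤ √(k * ‖x‖ ^ 2) * √(k * ‖y‖ ^ 2) := by
            gcongr
            · exact hnorm x
            · exact hnorm y
        _ = _ := by
            rw [Real.sqrt_mul hk'.le, Real.sqrt_mul hk'.le, Real.sqrt_sq (norm_nonneg _),
              Real.sqrt_sq (norm_nonneg _), mul_mul_mul_comm, Real.mul_self_sqrt hk'.le]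
    refine le_of_mul_le_mul_left ?_ hk'
    calc (k : ℝ) * ‖inner ℂ (restrict x F) (A (restrict y F))‖
        = ‖(k : ℂ) * inner ℂ (restrict x F) (A (restrict y F))‖ := by simp
      _ ≤ ∑ s ∈ Finset.range N, ‖T‖ * (‖restrict x (W s)‖ * ‖restrict y (W s)‖) := by
          rw [hsum]
          refine norm_sum_le_of_le _ fun s _ => (norm_inner_le_norm _ _).trans ?_
          calc _ ≤ ‖restrict x (W s)‖ * (‖T‖ * ‖restrict y (W s)‖) := by
                gcongr
                exact T.le_opNorm _
            _ = _ := by ring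
      _ ≤ ‖T‖ * (k * (‖x‖ * ‖y‖)) := by
          rw [← Finset.mul_sum]
          gcongr
      _ = k * (‖T‖ * (‖x‖ * ‖y‖)) := by ring
  refine ContinuousLinearMap.opNorm_le_of_re_inner_le (norm_nonneg _) fun y x hy hx => ?_
  have hx' : Tendsto (restrict x) atTop (𝓝 x) := lp.hasSum_single (by simp) x
  have hy' : Tendsto (restrict y) atTop (𝓝 y) := lp.hasSum_single (by simp) y
  have hlim := (hx'.inner (𝕜 := ℂ) ((A.continuous.tendsto y).comp hy')).norm
  have hle := le_of_tendsto hlim (Eventually.of_forall (key x y))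
  rw [hx, hy, mul_one, mul_one, norm_inner_symm] at hle
  exact (RCLike.re_le_norm _).trans hle

end l2

/-! ### Convolution operators through their matrix coefficients. -/

variable {Λ : Type*}

theorem mem_factorizations {w : FreeMonoid Λ} {p : FreeMonoid Λ × FreeMonoid Λ} :
    p ∈ factorizations w ↔ p.1 * p.2 = w := by
  simp [factorizations]

/-- The functional `ψ ↦ (φ * ψ)(w)`. -/
noncomputable def convolutionCLM (φ : FreeMonoid Λ → ℂ) (w : FreeMonoid Λ) : H Λ →L[ℂ] ℂ :=
  ∑ p ∈ factorizations w, φ p.1 • lp.evalCLM ℂ (fun _ : FreeMonoid Λ => ℂ) 2 p.2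

theorem convolutionCLM_apply (φ : FreeMonoid Λ → ℂ) (w : FreeMonoid Λ) (ψ : H Λ) :
    convolutionCLM φ w ψ = convolution φ ψ w := by
  simp only [convolutionCLM, sum_apply]
  rfl

section Single

variable [DecidableEq (FreeMonoid Λ)]

theorem convolution_single_mul (φ : FreeMonoid Λ → ℂ) (u v : FreeMonoid Λ) :
    convolution φ (lp.single 2 v (1 : ℂ) : H Λ) (u * v) = φ u := by
  rw [convolution, Finset.sum_eq_single (u, v)]
  · simp
  · rintro ⟨a, b⟩ hp hne
    have hab : a * b = u * v := mem_factorizations.1 hp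
    have hb : b ≠ v := by
      rintro rfl
      exact hne (by rw [mul_right_cancel hab])
    rw [lp.single_apply_ne _ _ _ hb, mul_zero]
  · intro hp
    exact absurd (mem_factorizations.2 (show u * v = u * v from rfl)) hp

theorem convolution_single_of_forall_ne (φ : FreeMonoid Λ → ℂ) {v w : FreeMonoid Λ}
    (h : ∀ u, u * v ≠ w) : convolution φ (lp.single 2 v (1 : ℂ) : H Λ) w = 0 := by
  refine Finset.sum_eq_zero ?_
  rintro ⟨a, b⟩ hp
  rw [mem_factorizations] at hp
  have hb : b ≠ v := by
    rintro rfl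
    exact h a hp
  rw [lp.single_apply_ne _ _ _ hb, mul_zero]

theorem convolution_single_one (φ : FreeMonoid Λ → ℂ) :
    convolution φ (lp.single 2 (1 : FreeMonoid Λ) (1 : ℂ) : H Λ) = φ := by
  funext w
  simpa using convolution_single_mul φ w 1

theorem isLeftConvolution_iff_single {φ : H Λ} {T : H Λ →L[ℂ] H Λ} :
    IsLeftConvolution φ T ↔ ∀ v w, T (lp.single 2 v (1 : ℂ)) w =
      convolution φ (lp.single 2 v (1 : ℂ) : H Λ) w := by
  refine ⟨fun h v w => by rw [h], fun h ψ => funext fun w => ?_⟩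
  have : (lp.evalCLM ℂ (fun _ : FreeMonoid Λ => ℂ) 2 w).comp T = convolutionCLM φ w :=
    clm_ext_single fun v => by
      rw [convolutionCLM_apply, ← h]
      rfl
  rw [← convolutionCLM_apply, ← this]
  rfl

/-- Since `φ * ξ_e = φ`, the symbol can only be `T ξ_e`. This removes the existential and leaves
conditions that pass to weak limits. -/
theorem mem_boundedLeftConvolutions_iff {T : H Λ →WOT[ℂ] H Λ} :
    T ∈ boundedLeftConvolutions Λ ↔ ∀ v w, T (lp.single 2 v (1 : ℂ)) w =
      convolution (T (lp.single 2 1 (1 : ℂ))) (lp.single 2 v (1 : ℂ) : H Λ) w := by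
  constructor
  · rintro ⟨φ, hφ⟩ v w
    have h1 : ⇑(T (lp.single 2 1 (1 : ℂ))) = φ := by
      rw [← ContinuousLinearMapWOT.toCLM_apply, hφ, convolution_single_one]
    rw [h1]
    exact isLeftConvolution_iff_single.1 hφ v w
  · exact fun h => ⟨_, isLeftConvolution_iff_single.2 h⟩

end Single

theorem continuous_wot_apply (ψ : H Λ) (w : FreeMonoid Λ) :
    Continuous fun T : H Λ →WOT[ℂ] H Λ => T ψ w :=
  ContinuousLinearMapWOT.continuous_dual_apply ψ
    (lp.evalCLM ℂ (fun _ : FreeMonoid Λ => ℂ) 2 w)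

theorem isClosed_boundedLeftConvolutions : IsClosed (boundedLeftConvolutions Λ) := by
  classical
  have : boundedLeftConvolutions Λ = ⋂ (v : FreeMonoid Λ) (w : FreeMonoid Λ),
      {T : H Λ →WOT[ℂ] H Λ | T (lp.single 2 v (1 : ℂ)) w =
        convolution (T (lp.single 2 1 (1 : ℂ))) (lp.single 2 v (1 : ℂ) : H Λ) w} := by
    ext T
    simp only [mem_boundedLeftConvolutions_iff, Set.mem_iInter, Set.mem_ofPred_eq]
  rw [this]
  refine isClosed_iInter fun v => isClosed_iInter fun w =>
    isClosed_eq (continuous_wot_apply _ _) ?_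
  exact continuous_finsetSum _ fun p _ => (continuous_wot_apply _ _).mul continuous_const

/-- The bounded left convolution operators, as a subspace. -/
def boundedLeftConvolutionSubmodule (Λ : Type*) : Submodule ℂ (H Λ →WOT[ℂ] H Λ) where
  carrier := boundedLeftConvolutions Λ
  zero_mem' := ⟨0, fun ψ => by funext w; simp [convolution]⟩
  add_mem' := by
    rintro S T ⟨φ, hφ⟩ ⟨χ, hχ⟩
    refine ⟨φ + χ, fun ψ => ?_⟩
    funext w
    have h1 := congrFun (hφ ψ) w
    have h2 := congrFun (hχ ψ) w
    simp only [ContinuousLinearMapWOT.toCLM_add, add_apply, lp.coeFn_add,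
      Pi.add_apply, h1, h2, convolution, add_mul, Finset.sum_add_distrib]
  smul_mem' := by
    rintro c T ⟨φ, hφ⟩
    refine ⟨c • φ, fun ψ => ?_⟩
    funext w
    have h1 := congrFun (hφ ψ) w
    simp only [ContinuousLinearMapWOT.toCLM_smul, smul_apply, lp.coeFn_smul,
      Pi.smul_apply, h1, convolution, smul_eq_mul, mul_assoc, Finset.mul_sum]

theorem wordOp_mem_boundedLeftConvolutions (u : FreeMonoid Λ) :
    ContinuousLinearMapWOT.ofCLM (wordOp u) ∈ boundedLeftConvolutions Λ := by
  classical
  rw [mem_boundedLeftConvolutions_iff]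
  intro v w
  simp only [ContinuousLinearMapWOT.ofCLM_apply, wordOp_single, mul_one]
  by_cases h : ∃ a, a * v = w
  · obtain ⟨a, rfl⟩ := h
    rw [convolution_single_mul]
    simp [Pi.single_apply]
  · push Not at h
    rw [convolution_single_of_forall_ne _ h]
    exact lp.single_apply_ne _ _ _ (h u).symm

theorem closure_wordSpan_subset : closure (wordSpan Λ : Set _) ⊆ boundedLeftConvolutions Λ := by
  refine closure_minimal ?_ isClosed_boundedLeftConvolutions
  change wordSpan Λ ≤ boundedLeftConvolutionSubmodule Λ
  refine Submodule.span_le.2 ?_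
  rintro _ ⟨u, rfl⟩
  exact wordOp_mem_boundedLeftConvolutions u

/-! ### Homogeneous components. -/

theorem norm_wordOp_apply (u : FreeMonoid Λ) (ψ : H Λ) : ‖wordOp u ψ‖ = ‖ψ‖ := by
  induction u using FreeMonoid.inductionOn' with
  | one => simp
  | of_mul α u ih =>
    rw [map_mul, mul_apply_eq_comp, ← ih]
    simp [wordOp]

theorem wordOp_apply_of_forall_ne {u w : FreeMonoid Λ} (h : ∀ v, u * v ≠ w) (ψ : H Λ) :
    wordOp u ψ w = 0 := by
  classical
  have : (lp.evalCLM ℂ (fun _ : FreeMonoid Λ => ℂ) 2 w).comp (wordOp u) = 0 :=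
    clm_ext_single fun v => by
      rw [ContinuousLinearMap.comp_apply, wordOp_single]
      exact lp.single_apply_ne (E := fun _ : FreeMonoid Λ => ℂ) 2 _ _ (h v).symm
  exact congrArg (fun f => f ψ) this

/-- A word has only one prefix of a given length, so the two vectors have disjoint supports. -/
theorem inner_wordOp_eq_zero {u v : FreeMonoid Λ} (hl : u.length = v.length) (huv : u ≠ v)
    (ψ χ : H Λ) : inner ℂ (wordOp u ψ) (wordOp v χ) = 0 := by
  rw [lp.inner_eq_tsum]
  refine (tsum_congr fun w => ?_).trans tsum_zero
  by_cases hu : ∃ a, u * a = w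
  · have hv : ∀ b, v * b ≠ w := by
      rintro b rfl
      obtain ⟨a, ha⟩ := hu
      refine huv (FreeMonoid.toList.injective ?_)
      exact (List.append_inj (congrArg FreeMonoid.toList ha) hl).1
    rw [wordOp_apply_of_forall_ne hv, inner_zero_right]
  · push Not at hu
    rw [wordOp_apply_of_forall_ne hu, inner_zero_left]

/-- The isometries `L_u`, for words `u` of a fixed length, have orthogonal ranges. -/
theorem orthogonalFamily_wordOp (n : ℕ) :
    OrthogonalFamily ℂ (fun _ : {u : FreeMonoid Λ // u.length = n} => H Λ)
      fun u => (⟨(wordOp u.1).toLinearMap, norm_wordOp_apply u.1⟩ : H Λ →ₗᵢ[ℂ] H Λ) :=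
  fun u v huv ψ χ =>
    inner_wordOp_eq_zero (u.2.trans v.2.symm) (fun h => huv (Subtype.ext h)) ψ χ

/-- Pythagoras for the orthogonal ranges; it supplies the Cauchy criterion for the homogeneous
series. -/
theorem norm_sum_wordOp_le {n : ℕ} (φ : FreeMonoid Λ → ℂ)
    (s : Finset {u : FreeMonoid Λ // u.length = n}) :
    ‖∑ u ∈ s, φ u • wordOp u.1‖ ≤ √(∑ u ∈ s, ‖φ u‖ ^ 2) := by
  refine ContinuousLinearMap.opNorm_le_bound _ (Real.sqrt_nonneg _) fun ψ => ?_
  have h := (orthogonalFamily_wordOp (Λ := Λ) n).norm_sum (fun u => φ u • ψ) s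
  have h' : (∑ u ∈ s, φ u • wordOp u.1) ψ = ∑ u ∈ s, wordOp u.1 (φ u • ψ) := by
    simp [sum_apply]
  change ‖∑ u ∈ s, wordOp u.1 (φ u • ψ)‖ ^ 2 = _ at h
  rw [h']
  refine le_of_sq_le_sq ?_ (by positivity)
  rw [h, mul_pow, Real.sq_sqrt (by positivity), Finset.sum_mul]
  simp [norm_smul, mul_pow]

/-- The homogeneous components of an `ℓ²` function give norm convergent series of operators. -/
theorem summable_smul_wordOp (φ : H Λ) (n : ℕ) :
    Summable fun u : {u : FreeMonoid Λ // u.length = n} => φ u • wordOp u.1 := by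
  have hs : Summable fun u : {u : FreeMonoid Λ // u.length = n} => ‖φ u‖ ^ 2 := by
    have := (φ.2.summable (by simp)).subtype {u : FreeMonoid Λ | u.length = n}
    simp only [Function.comp_def, ENNReal.toReal_ofNat, Real.rpow_ofNat] at this
    exact this
  rw [summable_iff_vanishing_norm] at hs ⊢
  intro ε hε
  obtain ⟨s, h⟩ := hs (ε ^ 2) (by positivity)
  refine ⟨s, fun t ht => (norm_sum_wordOp_le _ t).trans_lt ?_⟩
  rw [Real.sqrt_lt' hε]
  exact (le_abs_self _).trans_lt (h t ht)

/-- The operator `∑_{|u| = n} φ(u) L_u`. -/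
noncomputable def homogeneousOp (φ : H Λ) (n : ℕ) : H Λ →L[ℂ] H Λ :=
  ∑' u : {u : FreeMonoid Λ // u.length = n}, φ u • wordOp u.1

/-- By right cancellation at most one `u` satisfies `u v = w`, so at most one term of the series
survives. -/
theorem homogeneousOp_single [DecidableEq (FreeMonoid Λ)] (φ : H Λ) (n : ℕ)
    (v w : FreeMonoid Λ) :
    homogeneousOp φ n (lp.single 2 v (1 : ℂ)) w =
      if w.length = n + v.length then convolution φ (lp.single 2 v (1 : ℂ) : H Λ) w else 0 := by
  have hsum : HasSum (fun u : {u : FreeMonoid Λ // u.length = n} =>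
      φ u * (lp.single 2 (u.1 * v) (1 : ℂ) : H Λ) w)
      (homogeneousOp φ n (lp.single 2 v (1 : ℂ)) w) := by
    have := (((lp.evalCLM ℂ (fun _ : FreeMonoid Λ => ℂ) 2 w).comp
      (ContinuousLinearMap.apply ℂ (H Λ) (lp.single 2 v (1 : ℂ)))).hasSum
        (summable_smul_wordOp φ n).hasSum)
    simp only [← wordOp_single]
    exact this
  refine hsum.unique ?_
  by_cases h : ∃ a, a * v = w
  · obtain ⟨a, rfl⟩ := h
    rw [convolution_single_mul]
    split_ifs with hl
    · have ha : a.length = n := by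
        rw [FreeMonoid.length_mul] at hl
        omega
      convert hasSum_single (⟨a, ha⟩ : {u : FreeMonoid Λ // u.length = n}) ?_ using 1
      · simp
      · intro b hb
        have : a * v ≠ b.1 * v := fun h => hb (Subtype.ext (mul_right_cancel h).symm)
        rw [lp.single_apply_ne _ _ _ this, mul_zero]
    · convert hasSum_zero using 2 with b
      have : a * v ≠ b.1 * v := by
        intro h
        apply hl
        rw [h, FreeMonoid.length_mul, b.2]
      rw [lp.single_apply_ne _ _ _ this, mul_zero]
  · push Not at h
    rw [convolution_single_of_forall_ne _ h, ite_self]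
    convert hasSum_zero using 2 with b
    rw [lp.single_apply_ne _ _ _ (h b.1).symm, mul_zero]

theorem homogeneousOp_mem_closure (φ : H Λ) (n : ℕ) :
    ContinuousLinearMapWOT.ofCLM (homogeneousOp φ n) ∈ (wordSpan Λ).topologicalClosure := by
  have h : HasSum (fun u : {u : FreeMonoid Λ // u.length = n} =>
      ContinuousLinearMapWOT.ofCLM (φ u • wordOp u.1))
      (ContinuousLinearMapWOT.ofCLM (homogeneousOp φ n)) :=
    (ContinuousLinearMap.WOTofCLM (σ := RingHom.id ℂ) (E := H Λ) (F := H Λ)).hasSum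
      (summable_smul_wordOp φ n).hasSum
  refine mem_closure_of_tendsto h (Eventually.of_forall fun s => ?_)
  refine Submodule.sum_mem _ fun u _ => ?_
  rw [ContinuousLinearMapWOT.ofCLM_smul]
  exact Submodule.smul_mem _ _ (Submodule.subset_span ⟨u.1, rfl⟩)

/-! ### Cesàro means and approximation. -/

/-- The Cesàro means `∑_{n < k} (1 - n / k) ∑_{|u| = n} φ(u) L_u`. -/
noncomputable def cesaroOp (φ : H Λ) (k : ℕ) : H Λ →L[ℂ] H Λ :=
  ∑ n ∈ Finset.range k, (((k - n : ℕ) : ℂ) / k) • homogeneousOp φ n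

theorem cesaroOp_mem_closure (φ : H Λ) (k : ℕ) :
    ContinuousLinearMapWOT.ofCLM (cesaroOp φ k) ∈ (wordSpan Λ).topologicalClosure := by
  have : ContinuousLinearMapWOT.ofCLM (cesaroOp φ k) = ∑ n ∈ Finset.range k,
      (((k - n : ℕ) : ℂ) / k) • ContinuousLinearMapWOT.ofCLM (homogeneousOp φ n) :=
    map_sum (ContinuousLinearMap.WOTofCLM (σ := RingHom.id ℂ) (E := H Λ) (F := H Λ)) _ _
  rw [this]
  exact Submodule.sum_mem _ fun n _ => Submodule.smul_mem _ _ (homogeneousOp_mem_closure φ n)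

/-- If `w = a v`, the weight is `(k - |a|) / k`; otherwise both sides vanish. The symmetric min/max
form matches `norm_le_of_fejer_coeff`. -/
theorem cesaroOp_single [DecidableEq (FreeMonoid Λ)] (φ : H Λ) (k : ℕ) (v w : FreeMonoid Λ) :
    cesaroOp φ k (lp.single 2 v (1 : ℂ)) w =
      ((min w.length v.length + k - max w.length v.length : ℕ) : ℂ) / k *
        convolution φ (lp.single 2 v (1 : ℂ) : H Λ) w := by
  have hsum : cesaroOp φ k (lp.single 2 v (1 : ℂ)) w = ∑ n ∈ Finset.range k,
      ((k - n : ℕ) : ℂ) / k * homogeneousOp φ n (lp.single 2 v (1 : ℂ)) w := by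
    simp only [cesaroOp, sum_apply, lp.coeFn_sum, Finset.sum_apply]
    rfl
  rw [hsum]
  simp only [homogeneousOp_single]
  by_cases h : ∃ a, a * v = w
  · obtain ⟨a, rfl⟩ := h
    rw [FreeMonoid.length_mul, min_eq_right (by omega), max_eq_left (by omega)]
    simp only [add_left_inj, mul_ite, mul_zero, Finset.sum_ite_eq, Finset.mem_range]
    rw [show v.length + k - (a.length + v.length) = k - a.length by omega]
    split_ifs with ha
    · rfl
    · rw [Nat.sub_eq_zero_of_le (not_lt.1 ha)]
      simp
  · push Not at h
    simp [convolution_single_of_forall_ne _ h]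

theorem tendsto_fejer_weight (a b : ℕ) :
    Tendsto (fun k : ℕ => ((min a b + (k + 1) - max a b : ℕ) : ℂ) / (k + 1 : ℕ)) atTop (𝓝 1) := by
  have h : Tendsto (fun k : ℕ => 1 + (((min a b : ℕ) : ℂ) - (max a b : ℕ)) / ((k : ℂ) + 1)) atTop
      (𝓝 (1 + 0)) := by
    refine tendsto_const_nhds.add ?_
    have := (tendsto_one_div_add_atTop_nhds_zero_nat (𝕜 := ℂ)).const_mul
      (((min a b : ℕ) : ℂ) - (max a b : ℕ))
    simpa [div_eq_mul_inv] using this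
  rw [add_zero] at h
  refine h.congr' ?_
  filter_upwards [eventually_ge_atTop (max a b)] with k hk
  have hk0 : (k : ℂ) + 1 ≠ 0 := by exact_mod_cast k.succ_ne_zero
  rw [Nat.cast_sub (by omega)]
  push_cast
  field_simp
  ring

theorem boundedLeftConvolutions_subset_closure :
    boundedLeftConvolutions Λ ⊆ closure (wordSpan Λ : Set _) := by
  classical
  rintro T ⟨φ, hφ⟩
  rw [isLeftConvolution_iff_single] at hφ
  have hnorm : ∀ k, ‖cesaroOp φ (k + 1)‖ ≤ ‖T.toCLM‖ := fun k =>
    norm_le_of_fejer_coeff FreeMonoid.length k.succ_pos fun w v => by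
      have hk : ((k + 1 : ℕ) : ℂ) ≠ 0 := by exact_mod_cast k.succ_ne_zero
      rw [cesaroOp_single, hφ, ← mul_assoc, mul_div_cancel₀ _ hk]
  have hlim := tendsto_wot_of_tendsto_coeff hnorm (T := T.toCLM) fun w v => by
    simp only [cesaroOp_single, hφ]
    simpa using (tendsto_fejer_weight w.length v.length).mul_const
      (convolution φ (lp.single 2 v (1 : ℂ) : H Λ) w)
  -- For infinite `Λ` the means may already be limits of the span rather than members of it.
  rw [← closure_closure]
  exact mem_closure_of_tendsto hlim (Eventually.of_forall fun k => cesaroOp_mem_closure φ (k + 1))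

/-- An adjoined algebra is the span of the submonoid its generators generate, here the image of the
free monoid. -/
theorem adjoin_generators_eq_wordSpan :
    ((Algebra.adjoin ℂ (Set.range fun α : Λ =>
      ContinuousLinearMapWOT.ofCLM (generatorIsometry α).toContinuousLinearMap) :
        Subalgebra ℂ (H Λ →WOT[ℂ] H Λ)) : Set (H Λ →WOT[ℂ] H Λ)) = wordSpan Λ := by
  have h : (Submonoid.closure (Set.range fun α : Λ =>
      (ContinuousLinearMapWOT.ofCLM (generatorIsometry α).toContinuousLinearMap :
        H Λ →WOT[ℂ] H Λ)) : Set (H Λ →WOT[ℂ] H Λ)) =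
      Set.range fun w : FreeMonoid Λ => ContinuousLinearMapWOT.ofCLM (wordOp w) := by
    rw [← FreeMonoid.mrange_lift, MonoidHom.coe_mrange]
    congr 1
    have : FreeMonoid.lift (fun α : Λ =>
        (ContinuousLinearMapWOT.ofCLM (generatorIsometry α).toContinuousLinearMap :
          H Λ →WOT[ℂ] H Λ)) =
        ((ContinuousLinearMapWOT.ringEquiv (𝕜₁ := ℂ) (E := H Λ)).symm :
          (H Λ →L[ℂ] H Λ) →* (H Λ →WOT[ℂ] H Λ)).comp wordOp := by
      refine FreeMonoid.hom_eq fun α => ?_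
      simp [wordOp]
      rfl
    rw [this]
    rfl
  rw [← Subalgebra.coe_toSubmodule, Algebra.adjoin_eq_span, h]
  rfl

end FreeSemigroupAlgebra

theorem mainTheorem5 (Λ : Type*) :
    FreeSemigroupAlgebra.boundedLeftConvolutions Λ =
        closure (FreeSemigroupAlgebra.wordSpan Λ : Set _) ∧
      FreeSemigroupAlgebra.boundedLeftConvolutions Λ =
        (FreeSemigroupAlgebra.leftRegularAlgebra Λ : Set _) := by
  have h := FreeSemigroupAlgebra.boundedLeftConvolutions_subset_closure.antisymm
    (FreeSemigroupAlgebra.closure_wordSpan_subset (Λ := Λ))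
  refine ⟨h, h.trans ?_⟩
  rw [FreeSemigroupAlgebra.leftRegularAlgebra, Subalgebra.topologicalClosure_coe,
    FreeSemigroupAlgebra.adjoin_generators_eq_wordSpan]
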